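/- **Setting.** Let $D=[0,1]^2$ with points $(t,x)$. For $q\in L^2([0,1])$ put $\eta(q)(x)=\exp\int_0^x q$, $\varphi(q)(x)=\int_0^x\eta(q)\,dy$ and $\langle f,h\rangle_\eta=\int_0^1\eta fh\,dx$. Let $Q=\{q\in L^2([0,1]):\int_0^1q=0,\ \int_0^1\eta(q)=1\}$ and $T_q^*Q=\{p\in L^2([0,1]):\langle p,1\rangle_\eta=\langle p,\varphi\rangle_\eta=0\}$, with norm $\|f\|_q^2=\int_0^1\eta f^2\,dx$. Let $$\pi_q^*(f)=f-\begin{bmatrix}1&\varphi\end{bmatrix}\begin{bmatrix}1&1/2\\1/2&1/3\end{bmatrix}^{-1}\begin{bmatrix}\langle f,1\rangle_\eta\\\langle f,\varphi\rangle_\eta\end{bmatrix},\qquad \mathcal U(\nu,q)(x)=\tfrac12\int_x^1\eta(q)\,d\nu ,$$ where a function $\nu$ stands for the measure $\nu\,dx$. Let $(p,q)$ be a path in $T^*Q$ with $q\in H^2([0,1],L^2([0,1]))$ and $\dot q=\eta(q)p$ (so $p\in H^1([0,1],L^2([0,1]))$), and write $\eta(t,x)=\eta(q(t))(x)$. Its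 acceleration, as a covector, is $\left(\frac{D}{Dt}\dot q\right)^\flat=\pi_q^*\big(\dot p+\mathcal U(p^2,q)\big)$, and as a tangent vector $\frac{D}{Dt}\dot q=\eta\left(\frac{D}{Dt}\dot q\right)^\flat$. Let $\mathcal M_0(D)$ be the set of finite positive Radon measures $\Delta$ on $D$ with $\Delta_{t=0}=0$, in the sense that $\frac1h\Delta([0,h]\times[0,1])\to0$ as $h\to0^+$. Let $C_{1,0}(D)$ be the set of continuous functions on $D$ with continuous derivative in $t$. Write $\partial_t\Delta=\delta$, for a finite signed measure $\delta$, if $\int\partial_tf\,d\Delta+\int f\,d\delta=0$ for all $f\in C_{1,0}(D)$ with $f(1,\cdot)=0$ ($\delta$ is unique up to mass on $\{t=1\}$, and is taken without such mass). Let $$\mathrm{FR}_\eta(\Delta,\delta)=\int_Dr\Big(\frac{d\Delta}{d\lambda},\frac{d\delta}{d\lambda}\Big)\eta\,d\lambda,\qquad r(a,b)=\begin{cases}\frac{b^2}{4a}&a>0,\\0&a=b=0,\\+\infty&\text{otherwise,}\end{cases}$$ for any finite positive measure $\lambda$ dominating $\Delta$ and $\delta$, and $\mathrm{FR}_\eta(\Delta,\partial_t\Delta)=+\infty$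 if there is no such $\delta$. If there is one, $\Delta$ has a time disintegration $\Delta=\int_0^1\Delta_t\,dt$, and $\mathcal U(\Delta,q)(t,\cdot)=\mathcal U(\Delta_t,q(t))$. For a real-valued penalization $P$ let $$\mathcal F(\Delta)=\mathrm{FR}_\eta(\Delta,\partial_t\Delta)+\mathcal G(\Delta),\qquad \mathcal G(\Delta)=\int_0^1\left\|\left(\tfrac{D}{Dt}\dot q\right)^\flat+\pi_q^*(\mathcal U(\Delta,q))\right\|_q^2dt+P(p(1),q(1)),$$ with $\mathcal F(\Delta)=+\infty$ where the first term is infinite. Let $\langle D\mathcal G(\Delta),\nu\rangle$ denote the derivative of $s\mapsto\mathcal G(\Delta+s\nu)$ at $s=0$ (over $s\ge 0$). **Proposition.** Let $(p,q)$ be such a path and $\Delta\in\mathcal M_0(D)$. Suppose that (1) there is $g\in C_{1,0}(D)$ with $g(1,x)=0$ for all $x\in[0,1]$ and, for almost every $t\in[0,1]$ and all $x\in[0,1]$, $$\partial_tg+\frac1\eta g^2\le\eta\int_0^x\left(\frac{D}{Dt}\dot q+\eta\,\pi_q^*(\mathcal U(\Delta,q))\right)dy;$$ (2) $\langle-D\mathcal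 G(\Delta),\Delta\rangle=\mathrm{FR}_\eta(\Delta,\partial_t\Delta)$ (in particular the right-hand side is finite). Then $\Delta$ minimizes $\mathcal F$ over $\mathcal M_0(D)$, the path $(p,q)$ being fixed. -/

import Mathlib

open MeasureTheory Set Filter Topology
open scoped unitInterval ENNReal NNReal Matrix

noncomputable section

namespace DiffSpline

/-- The time-space domain `D = [0,1] × [0,1]`; a point is `(t, x)`. -/
abbrev Dom : Type := I × I

/-- The Hilbert space `L²([0,1])`. -/
abbrev L2 : Type := Lp ℝ 2 (volume : Measure I)

/-! ### The manifold `Q`, its cotangent spaces and its metric -/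

/-- `η(q)(x) = exp (∫_0^x q)`. -/
def eta (q : L2) (x : I) : ℝ := Real.exp (∫ u in Iic x, q u)

/-- `φ(q)(x) = ∫_0^x η(q)`. -/
def phi (q : L2) (x : I) : ℝ := ∫ y in Iic x, eta q y

/-- The submanifold `Q ⊂ L²([0,1])`, that is, `Diff_0^2([0,1])` in the variable
`q = ∂_x log ∂_x φ`. -/
def Q : Set L2 := {q | ∫ x : I, q x = 0 ∧ ∫ x : I, eta q x = 1}

/-- The weighted product `⟨f, h⟩_η = ∫_0^1 η f h dx`. Its square norm `⟨f, f⟩_η` is the dual metric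
on covectors of the metric `∫_0^1 X² / η dx` on tangent vectors. -/
def inEta (q : L2) (f h : I → ℝ) : ℝ := ∫ x : I, eta q x * f x * h x

/-- The cotangent space `T_q^* Q` inside `L²`: the covectors `p` for which `η p` is tangent, that is,
`∫ η p = 0` and `∫ φ η p = 0`. -/
def cotangent (q : L2) : Set L2 :=
  {p | inEta q p (fun _ => 1) = 0 ∧ inEta q p (phi q) = 0}

/-- The matrix with rows `(1, 1/2)` and `(1/2, 1/3)`, the Gram matrix of `1, φ` for `⟨·,·⟩_η`. -/
def H2 : Matrix (Fin 2) (Fin 2) ℝ := !![1, 1 / 2; 1 / 2, 1 / 3]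

/-- The dual projection `π_q^*` onto `T_q^* Q`. -/
def piStar (q : L2) (f : I → ℝ) (x : I) : ℝ :=
  f x - ![1, phi q x] ⬝ᵥ (H2⁻¹ *ᵥ ![inEta q f (fun _ => 1), inEta q f (phi q)])

/-- `𝒰(f, q)(x) = ½ ∫_x^1 η(q) f dy` for a function `f`. -/
def potential (q : L2) (f : I → ℝ) (x : I) : ℝ := (1 / 2) * ∫ y in Ici x, eta q y * f y

/-- `𝒰(ν, q)(x) = ½ ∫_x^1 η(q) dν` for a measure `ν` on `[0,1]`. -/
def potentialMeasure (q : L2) (ν : Measure I) (x : I) : ℝ :=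
  (1 / 2) * ∫ y in Ici x, eta q y ∂ν

/-! ### Paths -/

/-- `u ∈ H¹([0,1], L²)` (continuous representative) with weak derivative `du`. -/
def IsH1 (u du : I → L2) : Prop :=
  MemLp du 2 (volume : Measure I) ∧ ∀ t : I, u t = u 0 + ∫ s in Iic t, du s

/-- A path `(p(t), q(t)) ∈ T^*Q` with `q ∈ H²([0,1], L²)` and `dq/dt = η(q) p`. The fields `dq`, `ddq`
and `dp` are the time derivatives (determined by `q` and `p`, almost everywhere for `ddq` and `dp`;
`p = η(q)⁻¹ dq/dt` is automatically in `H¹([0,1], L²)`).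
Prescribed values at the initial, or at both endpoints only select a subset of these paths. -/
structure Path where
  q : I → L2
  dq : I → L2
  ddq : I → L2
  p : I → L2
  dp : I → L2
  q_h1 : IsH1 q dq
  dq_h1 : IsH1 dq ddq
  p_h1 : IsH1 p dp
  q_mem : ∀ t, q t ∈ Q
  p_mem : ∀ t, p t ∈ cotangent (q t)
  dq_eq : ∀ t, ∀ᵐ x : I, dq t x = eta (q t) x * p t x

/-- The weight `η` of a path as a function on `D`. -/
def Path.etaD (γ : Path) (z : Dom) : ℝ := eta (γ.q z.1) z.2

/-- The covector `(D/Dt dq/dt)^♭ = π_q^* (dp/dt + 𝒰(p², q))`: the projection of the Levi-Civita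
acceleration of the ambient space `L²` with the metric `∫ X² / η(q) dx`. -/
def Path.accFlat (γ : Path) (t : I) : I → ℝ :=
  piStar (γ.q t) (fun y => γ.dp t y + potential (γ.q t) (fun z => (γ.p t z) ^ 2) y)

/-- The acceleration `D/Dt dq/dt` itself, a tangent vector: the metric identifies a covector `a` with
the vector `η a`. -/
def Path.acc (γ : Path) (t x : I) : ℝ := eta (γ.q t) x * γ.accFlat t x

/-! ### Measures on `D` -/

/-- The time disintegration `Δ = ∫ Δ_t dt` of a finite measure on `D` whose time marginal is absolutely
continuous with respect to the Lebesgue measure: `slice Δ t = Δ_t`, for almost every `t`. -/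
def slice (Δ : FiniteMeasure Dom) (t : I) : Measure I :=
  ((Δ : Measure Dom).fst.rnDeriv volume t) • (Δ : Measure Dom).condKernel t

/-- `ℳ_0(D)`: the finite positive measures `Δ` on `D` with `Δ_{t=0} = 0`, expressed by
`(1/h) ∫_0^h Δ_t([0,1]) dt → 0` as `h → 0+` so as to make sense for every measure. -/
def M0 : Set (FiniteMeasure Dom) :=
  {Δ | Tendsto (fun h : ℝ => (Δ {z : Dom | (z.1 : ℝ) ≤ h} : ℝ) / h) (𝓝[>] 0) (𝓝 0)}

/-- `g ∈ C_{1,0}(D)` with (continuous) time derivative `dg`. -/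
def IsC10 (g dg : C(Dom, ℝ)) : Prop :=
  ∀ t x : I, HasDerivWithinAt (fun s : ℝ => g (projIcc 0 1 zero_le_one s, x)) (dg (t, x))
    (Icc 0 1) (t : ℝ)

/-- The integral of a continuous function against a finite signed measure. -/
def signedIntegral (δ : SignedMeasure Dom) (f : C(Dom, ℝ)) : ℝ :=
  ∫ z, f z ∂δ.toJordanDecomposition.posPart - ∫ z, f z ∂δ.toJordanDecomposition.negPart

/-- `∂_t Δ = δ` and `Δ_{t=0} = 0`, weakly: `⟨∂_t f, Δ⟩ + ⟨f, δ⟩ = 0` for every `f ∈ C_{1,0}(D)` with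
`f(1, ·) = 0`. -/
def IsTimeDeriv (Δ : FiniteMeasure Dom) (δ : SignedMeasure Dom) : Prop :=
  ∀ f df : C(Dom, ℝ), IsC10 f df → (∀ x : I, f (1, x) = 0) →
    ∫ z, df z ∂(Δ : Measure Dom) + signedIntegral δ f = 0

/-! ### The Fisher-Rao functional -/

/-- `r(x, y) = y² / (4 x)` for `x > 0`, `r(0, 0) = 0`, and `+∞` otherwise. -/
def r (x y : ℝ) : ℝ≥0∞ :=
  open Classical in
  if 0 < x then ENNReal.ofReal (y ^ 2 / (4 * x)) else if x = 0 ∧ y = 0 then 0 else ⊤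

/-- `FR_f(μ, ν) = ∫_D r(dμ/dλ, dν/dλ) f dλ`, with the dominating measure `λ = μ + |ν|`
(the value is the same for every dominating measure, `r` being one-homogeneous). -/
def FR (f : Dom → ℝ) (μ : FiniteMeasure Dom) (ν : SignedMeasure Dom) : ℝ≥0∞ :=
  let lam : Measure Dom := (μ : Measure Dom) + ν.totalVariation
  ∫⁻ z, r (((μ : Measure Dom).rnDeriv lam z).toReal) (ν.rnDeriv lam z) * ENNReal.ofReal (f z) ∂lam

/-- `FR_f(Δ, ∂_t Δ)` for `Δ ∈ ℳ_0(D)`, equal to `+∞` if `∂_t Δ` is not a finite measure.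
The relation `IsTimeDeriv Δ δ` determines `δ` up to the mass that it gives to `{t = 1}`, where `Δ` has
no mass; a `δ` that charges this set has infinite Fisher-Rao value, so the infimum is the value at the
derivative `∂_t Δ` itself. -/
def FRdt (f : Dom → ℝ) (Δ : FiniteMeasure Dom) : ℝ≥0∞ :=
  ⨅ (δ : SignedMeasure Dom) (_ : IsTimeDeriv Δ δ), FR f Δ δ

/-! ### The functionals -/

/-- The covector `π_q^*(𝒰(Δ, q))` at time `t`. -/
def Path.projPotential (γ : Path) (Δ : FiniteMeasure Dom) (t : I) : I → ℝ :=
  piStar (γ.q t) (potentialMeasure (γ.q t) (slice Δ t))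

/-- `𝒢(Δ) = ∫_0^1 ‖(D/Dt dq/dt)^♭ + π_q^*(𝒰(Δ, q))‖²_q dt + P(p(1), q(1))`. -/
def Path.G (γ : Path) (P : L2 → L2 → ℝ) (Δ : FiniteMeasure Dom) : ℝ :=
  (∫ t : I, inEta (γ.q t) (fun x => γ.accFlat t x + γ.projPotential Δ t x)
    (fun x => γ.accFlat t x + γ.projPotential Δ t x)) + P (γ.p 1) (γ.q 1)

/-- `ℱ(Δ) = FR_η(Δ, ∂_t Δ) + 𝒢(Δ)`. -/
def Path.F (γ : Path) (P : L2 → L2 → ℝ) (Δ : FiniteMeasure Dom) : EReal :=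
  (FRdt γ.etaD Δ : EReal) + ((γ.G P Δ : ℝ) : EReal)

/-- `⟨D𝒢(Δ), ν⟩`: the derivative of `s ↦ 𝒢(Δ + s ν)` at `s = 0`, over `s ≥ 0`. -/
def Path.DG (γ : Path) (P : L2 → L2 → ℝ) (Δ ν : FiniteMeasure Dom) : ℝ :=
  derivWithin (fun s : ℝ => γ.G P (Δ + s.toNNReal • ν)) (Ici 0) 0

/-- The right-hand side `η ∫_0^x (D/Dt dq/dt + π_q^*(𝒰(Δ, q))) dy` of the Riccati inequality, where the
covector `π_q^*(𝒰(Δ, q))` is identified with the tangent vector `η π_q^*(𝒰(Δ, q))`. -/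
def Path.riccatiRhs (γ : Path) (Δ : FiniteMeasure Dom) (t x : I) : ℝ :=
  eta (γ.q t) x * ∫ y in Iic x, (γ.acc t y + eta (γ.q t) y * γ.projPotential Δ t y)

end DiffSpline

end

/-!
The functional `𝒢` is the integral in time of the square norm of an affine function of `Δ`, hence
convex, and the Fisher-Rao functional has the dual lower bound
`FR_η(Δ', δ') ≥ ∫ g dδ' - ∫ g² / η dΔ'` for every continuous `g`, which is Young's inequality
`η b² / (4 a) ≥ g b - g² a / η` for the densities `a`, `b` (`ofReal_signedIntegral_sub_le_FR`).

Let `V` be the residual `(D/Dt dq/dt)^♭ + π_q^*(𝒰(Δ, q))`. Convexity gives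
`𝒢(Δ') - 𝒢(Δ) ≥ 2 ∫ ⟨V, π_q^* 𝒰(Δ', q)⟩_η dt - 2 ∫ ⟨V, π_q^* 𝒰(Δ, q)⟩_η dt` (`Path.G_sub_le`). Since `V`
lies in the range of the orthogonal projection `π_q^*`, exchanging the integrals in `x` and `y` turns
`2 ⟨V, π_q^* 𝒰(Δ', q)⟩_η` into the integral against `Δ'_t` of the right-hand side `R` of the Riccati
inequality (`Path.integral_riccatiRhs`). A subsolution `g` then gives
`∫ R dΔ' ≥ ∫ (∂_t g + g² / η) dΔ' = - ∫ g d(∂_t Δ') + ∫ g² / η dΔ' ≥ - FR_η(Δ', ∂_t Δ')`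
(`Path.ofReal_neg_linearPart_le_FRdt`). For `Δ' = Δ` the two ends agree by the second hypothesis,
because `𝒢` is a quadratic polynomial on the ray through `Δ` and `⟨D𝒢(Δ), Δ⟩ = ∫ R dΔ`
(`Path.DG_self`). Adding the inequalities proves minimality.

These computations involve real integrals, so integrability has to be secured. A measure whose time
derivative is a finite measure has a time marginal with bounded density (`IsTimeDeriv.fst_le`), so that
its potential is bounded. Measures without such a derivative have infinite Fisher-Rao value. In time,
all covector fields are handled as square-integrable curves in `L²([0,1])` (`IsL2Curve`).
-/

namespace DiffSpline

/-! ### Weighted products and the projection at a fixed time -/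

lemma memLp_two (f : L2) : MemLp f 2 (volume : Measure I) := Lp.memLp f

/-- The indicator functions of the intervals `[0, x]` as a curve in `L²`. -/
noncomputable def indIic (x : I) : L2 :=
  indicatorConstLp 2 (measurableSet_Iic (a := x)) (measure_ne_top _ _) (1 : ℝ)

lemma continuous_indIic : Continuous indIic := by
  refine continuous_indicatorConstLp_set (by norm_num) fun x => ?_
  have h : Tendsto (fun y : I => edist y x) (𝓝 x) (𝓝 0) := by
    have : Continuous fun y : I => edist y x := by fun_prop
    simpa using this.tendsto x
  refine tendsto_of_tendsto_of_tendsto_of_le_of_le tendsto_const_nhds h (fun _ => zero_le) ?_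
  intro y
  simp only
  rw [← edist_comm, ← unitInterval.volume_uIoc]
  refine measure_mono ?_
  rintro z (⟨h1, h2⟩ | ⟨h1, h2⟩)
  · simp only [mem_Iic, not_le] at h1 h2
    exact mem_uIoc.2 (Or.inr ⟨h2, h1⟩)
  · simp only [mem_Iic, not_le] at h1 h2
    exact mem_uIoc.2 (Or.inl ⟨h2, h1⟩)

lemma inner_indIic (x : I) (f : L2) : inner ℝ (indIic x) f = ∫ y in Iic x, f y :=
  L2.inner_indicatorConstLp_one _ _ _

/-- In this form the joint continuity of `η` in time and space is that of the inner product. -/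
lemma eta_eq (q : L2) (x : I) : eta q x = Real.exp (inner ℝ (indIic x) q) := by
  rw [inner_indIic, eta]

lemma eta_pos (q : L2) (x : I) : 0 < eta q x := Real.exp_pos _

lemma continuous_eta_comp {X : Type*} [TopologicalSpace X] {q : X → L2} (hq : Continuous q) :
    Continuous fun z : X × I => eta (q z.1) z.2 := by
  simp only [eta_eq]
  exact Real.continuous_exp.comp
    ((continuous_indIic.comp continuous_snd).inner (hq.comp continuous_fst))

lemma continuous_eta (q : L2) : Continuous (eta q) := by
  simp only [funext (eta_eq q)]
  exact Real.continuous_exp.comp (continuous_indIic.inner continuous_const)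

lemma integrable_of_continuous {X : Type*} [TopologicalSpace X] [CompactSpace X] [T2Space X]
    [MeasurableSpace X] [OpensMeasurableSpace X] {μ : Measure X} [IsFiniteMeasure μ] {c : X → ℝ}
    (hc : Continuous c) : Integrable c μ :=
  (integrableOn_univ (μ := μ)).1 (hc.continuousOn.integrableOn_compact isCompact_univ)

/-- Primitives of continuous functions on `[0,1]`, written as interval integrals. -/
lemma setIntegral_Iic_eq {c : I → ℝ} (x : I) :
    ∫ y in Iic x, c y = ∫ s in (0 : ℝ)..x, c (projIcc 0 1 zero_le_one s) := by
  have hpre : Iic x = ((↑) : I → ℝ) ⁻¹' Icc 0 (x : ℝ) := by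
    ext y
    simp [y.2.1]
  have hmap := unitInterval.measurableEmbedding_coe.setIntegral_map (μ := volume)
    (fun s : ℝ => c (projIcc 0 1 zero_le_one s)) (Icc 0 (x : ℝ))
  rw [unitInterval.measurePreserving_coe.map_eq, Measure.restrict_restrict measurableSet_Icc,
    inter_eq_self_of_subset_left (Icc_subset_Icc_right x.2.2)] at hmap
  rw [intervalIntegral.integral_of_le x.2.1, ← integral_Icc_eq_integral_Ioc, hmap, ← hpre]
  simp only [projIcc_val]

lemma memLp_of_continuous {c : I → ℝ} (hc : Continuous c) : MemLp c 2 (volume : Measure I) :=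
  (Lp.memLp (ContinuousMap.toLp (E := ℝ) 2 (volume : Measure I) ℝ ⟨c, hc⟩)).ae_eq
    (ContinuousMap.coeFn_toLp (𝕜 := ℝ) _ _)

lemma continuous_phi (q : L2) : Continuous (phi q) := by
  have h : phi q =
      fun x => inner ℝ (indIic x) ((memLp_of_continuous (continuous_eta q)).toLp _) := by
    ext x
    rw [inner_indIic, phi]
    exact (integral_congr_ae (ae_restrict_of_ae (MemLp.coeFn_toLp _))).symm
  rw [h]
  exact continuous_indIic.inner continuous_const

/-- The moments of `φ` for the weight `η = φ'`, by the substitution `u = φ(x)`; they give the Gram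
matrix of `1, φ`. -/
lemma integral_eta_mul_phi_pow {q : L2} (hq : q ∈ Q) (k : ℕ) :
    ∫ x : I, eta q x * phi q x ^ k = 1 / (k + 1) := by
  set e : ℝ → ℝ := fun s => eta q (projIcc 0 1 zero_le_one s)
  have he : Continuous e := (continuous_eta q).comp continuous_projIcc
  have huniv : (univ : Set I) = Iic 1 := by
    ext x
    simp [unitInterval.le_one']
  have h1 : ∫ s in (0 : ℝ)..1, e s = 1 := by
    have := hq.2
    rw [← setIntegral_univ, huniv, setIntegral_Iic_eq] at this
    exact this
  have hd : ∀ s, HasDerivAt (fun s => (∫ u in (0 : ℝ)..s, e u) ^ (k + 1) / (k + 1))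
      (e s * (∫ u in (0 : ℝ)..s, e u) ^ k) s := fun s => by
    have := ((he.integral_hasStrictDerivAt 0 s).hasDerivAt.pow (k + 1)).div_const (k + 1 : ℝ)
    refine this.congr_deriv ?_
    push_cast
    field_simp
  have hc : Continuous fun s => ∫ u in (0 : ℝ)..s, e u :=
    intervalIntegral.continuous_primitive (fun a b => he.intervalIntegrable a b) 0
  rw [← setIntegral_univ, huniv, setIntegral_Iic_eq]
  have hcongr : ∫ s in (0 : ℝ)..(1 : I), eta q (projIcc 0 1 zero_le_one s) *
      phi q (projIcc 0 1 zero_le_one s) ^ k =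
      ∫ s in (0 : ℝ)..1, e s * (∫ u in (0 : ℝ)..s, e u) ^ k := by
    refine intervalIntegral.integral_congr fun s hs => ?_
    rw [Icc.coe_one, uIcc_of_le zero_le_one] at hs
    simp only [phi, setIntegral_Iic_eq, projIcc_of_mem _ hs, e]
  rw [hcongr, intervalIntegral.integral_eq_sub_of_hasDerivAt (fun s _ => hd s)
    ((he.mul (hc.pow k)).intervalIntegrable _ _), h1]
  simp

lemma inEta_one_one {q : L2} (hq : q ∈ Q) : inEta q (fun _ => 1) (fun _ => 1) = 1 := by
  simpa [inEta] using hq.2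

lemma inEta_phi_one {q : L2} (hq : q ∈ Q) : inEta q (phi q) (fun _ => 1) = 1 / 2 := by
  have := integral_eta_mul_phi_pow hq 1
  norm_num at this
  simpa [inEta] using this

lemma inEta_phi_phi {q : L2} (hq : q ∈ Q) : inEta q (phi q) (phi q) = 1 / 3 := by
  have := integral_eta_mul_phi_pow hq 2
  norm_num at this
  simpa [inEta, mul_assoc, sq] using this

lemma inEta_comm (q : L2) (f h : I → ℝ) : inEta q f h = inEta q h f := by
  simp only [inEta, mul_right_comm]

lemma memLp_continuous_mul {c f : I → ℝ} (hc : Continuous c)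
    (hf : MemLp f 2 (volume : Measure I)) : MemLp (fun x => c x * f x) 2 (volume : Measure I) := by
  obtain ⟨C, hC⟩ := isCompact_univ.exists_bound_of_continuousOn hc.continuousOn
  refine hf.of_le_mul (c := C) (hc.aestronglyMeasurable.mul hf.1) (ae_of_all _ fun x => ?_)
  rw [norm_mul]
  exact mul_le_mul_of_nonneg_right (hC x trivial) (norm_nonneg _)

section Fixed

variable {q : L2} {f h k : I → ℝ}

lemma integrable_inEta (hf : MemLp f 2 (volume : Measure I)) (hh : MemLp h 2 (volume : Measure I)) :
    Integrable fun x : I => eta q x * f x * h x :=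
  (memLp_continuous_mul (continuous_eta q) hf).integrable_mul hh

lemma inEta_add_left (hf : MemLp f 2 (volume : Measure I)) (hh : MemLp h 2 (volume : Measure I))
    (hk : MemLp k 2 (volume : Measure I)) :
    inEta q (fun x => f x + h x) k = inEta q f k + inEta q h k := by
  rw [inEta, inEta, inEta, ← integral_add (integrable_inEta hf hk) (integrable_inEta hh hk)]
  congr with x; ring

lemma inEta_smul_left (a : ℝ) (f h : I → ℝ) :
    inEta q (fun x => a * f x) h = a * inEta q f h := by
  rw [inEta, inEta, ← integral_const_mul]
  congr with x; ring

lemma inEta_add_right (hf : MemLp f 2 (volume : Measure I)) (hh : MemLp h 2 (volume : Measure I))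
    (hk : MemLp k 2 (volume : Measure I)) :
    inEta q k (fun x => f x + h x) = inEta q k f + inEta q k h := by
  simp only [inEta_comm q k, inEta_add_left hf hh hk]

lemma inEta_smul_right (a : ℝ) (f h : I → ℝ) :
    inEta q h (fun x => a * f x) = a * inEta q h f := by
  simp only [inEta_comm q h, inEta_smul_left]

lemma inEta_self_nonneg (q : L2) (f : I → ℝ) : 0 ≤ inEta q f f :=
  integral_nonneg fun x => by
    rw [mul_assoc]; exact mul_nonneg (eta_pos q x).le (mul_self_nonneg _)

/-- Expansion of the square norm along a line. -/
lemma inEta_add_smul_self (hf : MemLp f 2 (volume : Measure I))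
    (hh : MemLp h 2 (volume : Measure I)) (s : ℝ) :
    inEta q (fun x => f x + s * h x) (fun x => f x + s * h x) =
      inEta q f f + 2 * s * inEta q f h + s ^ 2 * inEta q h h := by
  have hs := hh.const_mul s
  have hfs : MemLp (fun x => f x + s * h x) 2 (volume : Measure I) := hf.add hs
  rw [inEta_add_left hf hs hfs, inEta_add_right hf hs hf, inEta_add_right hf hs hs,
    inEta_smul_left, inEta_smul_left, inEta_smul_right, inEta_smul_right, inEta_comm q h f]
  ring

lemma H2_inv : H2⁻¹ = !![4, -6; -6, 12] := by
  refine Matrix.inv_eq_left_inv ?_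
  ext i j
  fin_cases i <;> fin_cases j <;> norm_num [H2, Matrix.mul_apply, Fin.sum_univ_two]

lemma piStar_apply (q : L2) (f : I → ℝ) (x : I) :
    piStar q f x = f x
      + ((-4 * inEta q f (fun _ => 1) + 6 * inEta q f (phi q))
      + (6 * inEta q f (fun _ => 1) - 12 * inEta q f (phi q)) * phi q x) := by
  simp [piStar, H2_inv, Matrix.mulVec, dotProduct, Fin.sum_univ_two]
  ring

lemma memLp_const_one : MemLp (fun _ : I => (1 : ℝ)) 2 (volume : Measure I) := memLp_const 1

lemma memLp_phi : MemLp (phi q) 2 (volume : Measure I) := memLp_of_continuous (continuous_phi q)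

lemma memLp_affine_phi (a b : ℝ) :
    MemLp (fun x : I => a + b * phi q x) 2 (volume : Measure I) :=
  (memLp_const a).add (memLp_phi.const_mul b)

lemma memLp_piStar (hf : MemLp f 2 (volume : Measure I)) :
    MemLp (piStar q f) 2 (volume : Measure I) := by
  simp only [funext (piStar_apply q f)]
  exact hf.add (memLp_affine_phi _ _)

lemma piStar_add (hf : MemLp f 2 (volume : Measure I)) (hh : MemLp h 2 (volume : Measure I)) :
    piStar q (fun x => f x + h x) = fun x => piStar q f x + piStar q h x := by
  ext x
  simp only [piStar_apply, inEta_add_left hf hh memLp_const_one, inEta_add_left hf hh memLp_phi]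
  ring

lemma piStar_smul (a : ℝ) (f : I → ℝ) :
    piStar q (fun x => a * f x) = fun x => a * piStar q f x := by
  ext x
  simp only [piStar_apply, inEta_smul_left]
  ring

lemma inEta_affine_phi_left (hk : MemLp k 2 (volume : Measure I)) (a b : ℝ) :
    inEta q (fun x => a + b * phi q x) k = a * inEta q (fun _ => 1) k + b * inEta q (phi q) k := by
  rw [inEta_add_left (memLp_const a) (memLp_phi.const_mul b) hk, inEta_smul_left,
    ← inEta_smul_left a]
  simp

lemma piStar_mem_orthogonal (hq : q ∈ Q) (hf : MemLp f 2 (volume : Measure I)) :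
    inEta q (piStar q f) (fun _ => 1) = 0 ∧ inEta q (piStar q f) (phi q) = 0 := by
  simp only [funext (piStar_apply q f)]
  rw [inEta_add_left hf (memLp_affine_phi _ _) memLp_const_one,
    inEta_add_left hf (memLp_affine_phi _ _) memLp_phi, inEta_affine_phi_left memLp_const_one,
    inEta_affine_phi_left memLp_phi, inEta_one_one hq, inEta_phi_one hq, inEta_phi_phi hq,
    inEta_comm q _ (phi q), inEta_comm q _ (phi q), inEta_phi_one hq]
  constructor <;> ring

/-- `π_q^*` is the orthogonal projection for `⟨·,·⟩_η`. -/
lemma inEta_piStar_piStar (hq : q ∈ Q) (hf : MemLp f 2 (volume : Measure I))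
    (hh : MemLp h 2 (volume : Measure I)) :
    inEta q (piStar q f) (piStar q h) = inEta q (piStar q f) h := by
  obtain ⟨h1, h2⟩ := piStar_mem_orthogonal hq hf
  simp only [funext (piStar_apply q h)]
  rw [inEta_add_right hh (memLp_affine_phi _ _) (memLp_piStar hf), inEta_comm q (piStar q f),
    inEta_comm q (piStar q f), inEta_affine_phi_left (memLp_piStar hf), inEta_comm q _ (piStar q f),
    inEta_comm q _ (piStar q f), inEta_comm q _ (piStar q f), h1, h2]
  ring

/-- Exchanging the order of integration in the pairing with a potential. -/
lemma inEta_potentialMeasure (hf : MemLp f 2 (volume : Measure I)) (ν : Measure I)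
    [IsFiniteMeasure ν] :
    2 * inEta q f (potentialMeasure q ν) =
      ∫ y, eta q y * (∫ x in Iic y, eta q x * f x) ∂ν := by
  have hη : Integrable (fun x : I => eta q x * f x) :=
    (memLp_continuous_mul (continuous_eta q) hf).integrable (by norm_num)
  have hs : MeasurableSet {z : I × I | z.1 ≤ z.2} := measurableSet_le measurable_fst measurable_snd
  have hint : Integrable ({z : I × I | z.1 ≤ z.2}.indicator
      fun z => eta q z.1 * f z.1 * eta q z.2) ((volume : Measure I).prod ν) :=
    (hη.mul_prod (integrable_of_continuous (continuous_eta q))).indicator hs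
  have hswap := integral_integral_swap (f := fun x y => ({z : I × I | z.1 ≤ z.2}.indicator
      fun z => eta q z.1 * f z.1 * eta q z.2) (x, y)) hint
  have hl : ∀ x : I, (∫ y, ({z : I × I | z.1 ≤ z.2}.indicator
      fun z => eta q z.1 * f z.1 * eta q z.2) (x, y) ∂ν) =
      eta q x * f x * ∫ y in Ici x, eta q y ∂ν := fun x => by
    rw [← integral_const_mul, ← integral_indicator measurableSet_Ici]
    rfl
  have hr : ∀ y : I, (∫ x, ({z : I × I | z.1 ≤ z.2}.indicator
      fun z => eta q z.1 * f z.1 * eta q z.2) (x, y)) =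
      eta q y * ∫ x in Iic y, eta q x * f x := fun y => by
    rw [← integral_const_mul, ← integral_indicator measurableSet_Iic]
    congr with x
    simp only [indicator, mem_ofPred_eq, mem_Iic]
    split_ifs <;> ring
  simp only [hl, hr] at hswap
  rw [← hswap, inEta, ← integral_const_mul]
  congr with x
  rw [potentialMeasure]
  ring

end Fixed

/-! ### Square-integrable curves of functions -/

/-- A map into a separable metric space is measurable if its distance to every point is. -/
lemma measurable_of_measurable_dist {α E : Type*} [MeasurableSpace α] [PseudoMetricSpace E]
    [SecondCountableTopology E] [MeasurableSpace E] [BorelSpace E] {f : α → E}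
    (hf : ∀ y, Measurable fun a => dist (f a) y) : Measurable f := by
  refine measurable_of_isOpen fun U hU => ?_
  choose! ρ hρ hsub using fun y (hy : y ∈ U) => Metric.isOpen_iff.1 hU y hy
  obtain ⟨T, hTU, hT, hTeq⟩ := TopologicalSpace.isOpen_biUnion_countable U
    (fun y => Metric.ball y (ρ y)) fun _ _ => Metric.isOpen_ball
  have hU' : U = ⋃ y ∈ T, Metric.ball y (ρ y) := by
    rw [hTeq]
    refine Subset.antisymm (fun y hy => mem_biUnion hy (Metric.mem_ball_self (hρ y hy))) ?_
    exact iUnion₂_subset hsub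
  rw [hU', preimage_iUnion₂]
  exact MeasurableSet.biUnion hT fun y _ => measurableSet_lt (hf y) measurable_const

/-- Time-dependent functions on `[0,1]` that are, for almost every time, represented by a
square-integrable curve in `L²([0,1])`. Neither joint measurability nor any property at
exceptional times is required. -/
def IsL2Curve (f : I → I → ℝ) : Prop :=
  ∃ F : I → L2, MemLp F 2 (volume : Measure I) ∧ ∀ᵐ t : I, f t =ᵐ[volume] F t

/-- Multiplication by the time slices of a continuous function on `D`, as a norm-continuous family
of operators on `L²`. -/
lemma exists_continuous_mul_operator {c : Dom → ℝ} (hc : Continuous c) :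
    ∃ B : I → L2 →L[ℝ] L2, Continuous B ∧
      ∀ t (f : L2), B t f =ᵐ[volume] fun x => c (t, x) * f x := by
  let C : I → Lp ℝ ∞ (volume : Measure I) := fun t =>
    ContinuousMap.toLp ∞ volume ℝ ((ContinuousMap.curry ⟨c, hc⟩) t)
  have hC : Continuous C :=
    (ContinuousMap.toLp (E := ℝ) ∞ volume ℝ).continuous.comp (ContinuousMap.continuous _)
  refine ⟨fun t => (ContinuousLinearMap.mul ℝ ℝ).holderL (volume : Measure I) ∞ 2 2 (C t),
    ContinuousLinearMap.continuous _ |>.comp hC, fun t f => ?_⟩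
  filter_upwards [(ContinuousLinearMap.mul ℝ ℝ).coeFn_holder (r := 2) (C t) f,
    ContinuousMap.coeFn_toLp (p := ∞) (𝕜 := ℝ) (volume : Measure I)
      ((ContinuousMap.curry ⟨c, hc⟩) t)] with x h2 h3
  refine Eq.trans h2 ?_
  exact congrArg (· * f x) h3

namespace IsL2Curve

variable {f h : I → I → ℝ}

lemma of_memLp {F : I → L2} (hF : MemLp F 2 (volume : Measure I)) :
    IsL2Curve fun t x => F t x :=
  ⟨F, hF, ae_of_all _ fun _ => EventuallyEq.rfl⟩

lemma congr (hf : IsL2Curve f) (hfh : ∀ᵐ t : I, h t =ᵐ[volume] f t) : IsL2Curve h := by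
  obtain ⟨F, hF, hfF⟩ := hf
  refine ⟨F, hF, ?_⟩
  filter_upwards [hfF, hfh] with t h1 h2 using h2.trans h1

lemma memLp (hf : IsL2Curve f) : ∀ᵐ t : I, MemLp (f t) 2 (volume : Measure I) := by
  obtain ⟨F, hF, hfF⟩ := hf
  filter_upwards [hfF] with t ht using (memLp_two (F t)).ae_eq ht.symm

lemma add (hf : IsL2Curve f) (hh : IsL2Curve h) : IsL2Curve fun t x => f t x + h t x := by
  obtain ⟨F, hF, hfF⟩ := hf
  obtain ⟨H, hH, hhH⟩ := hh
  refine ⟨F + H, hF.add hH, ?_⟩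
  filter_upwards [hfF, hhH] with t h1 h2
  filter_upwards [h1, h2, Lp.coeFn_add (F t) (H t)] with x h3 h4 h5
  rw [h3, h4, Pi.add_apply, h5, Pi.add_apply]

lemma of_scalar {a : I → ℝ} (ha : MemLp a 2 (volume : Measure I)) :
    IsL2Curve fun t _ => a t := by
  let one : L2 := Lp.const 2 volume (1 : ℝ)
  refine ⟨_, (ContinuousLinearMap.toSpanSingleton ℝ one).comp_memLp' ha, ?_⟩
  refine ae_of_all _ fun t => ?_
  filter_upwards [Lp.coeFn_smul (a t) one, Lp.coeFn_const (p := 2) (μ := (volume : Measure I))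
    (1 : ℝ)] with x h1 h2
  simp only [Function.comp, ContinuousLinearMap.toSpanSingleton_apply]
  rw [h1, Pi.smul_apply, h2]
  simp

/-- Multiplication by a function which is continuous on `D`. -/
lemma continuous_mul {c : Dom → ℝ} (hc : Continuous c) (hf : IsL2Curve f) :
    IsL2Curve fun t x => c (t, x) * f t x := by
  obtain ⟨F, hF, hfF⟩ := hf
  obtain ⟨B, hB, hBc⟩ := exists_continuous_mul_operator hc
  obtain ⟨M, hM⟩ := isCompact_univ.exists_bound_of_continuousOn hB.continuousOn
  refine ⟨fun t => B t (F t), ?_, ?_⟩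
  · refine hF.of_le_mul (c := M)
      ((ContinuousLinearMap.id ℝ (L2 →L[ℝ] L2)).aestronglyMeasurable_comp₂ hB.aestronglyMeasurable hF.1) (ae_of_all _ fun t => ?_)
    exact (B t).le_of_opNorm_le (hM t trivial) _
  · filter_upwards [hfF] with t ht
    filter_upwards [ht, hBc t (F t)] with x h1 h2
    rw [h1, h2]

lemma integrable_integral_mul (hf : IsL2Curve f) (hh : IsL2Curve h) :
    Integrable (fun t => ∫ x : I, f t x * h t x) (volume : Measure I) := by
  obtain ⟨F, hF, hfF⟩ := hf
  obtain ⟨H, hH, hhH⟩ := hh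
  have hint : Integrable (fun t => inner ℝ (F t) (H t)) (volume : Measure I) := by
    refine (hF.norm.integrable_mul hH.norm).mono' (hF.1.inner hH.1) (ae_of_all _ fun t => ?_)
    exact norm_inner_le_norm _ _
  refine hint.congr ?_
  filter_upwards [hfF, hhH] with t h1 h2
  rw [L2.inner_def]
  refine integral_congr_ae ?_
  filter_upwards [h1, h2] with x h3 h4
  rw [h3, h4]
  simp [mul_comm]

lemma memLp_integral_mul_continuous {c : Dom → ℝ} (hc : Continuous c) (hf : IsL2Curve f) :
    MemLp (fun t => ∫ x : I, c (t, x) * f t x) 2 (volume : Measure I) := by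
  obtain ⟨F, hF, hfF⟩ := hf.continuous_mul hc
  let one : L2 := Lp.const 2 volume (1 : ℝ)
  refine ((innerSL ℝ one).comp_memLp' hF).ae_eq ?_
  filter_upwards [hfF] with t ht
  simp only [Function.comp, innerSL_apply_apply]
  rw [L2.inner_def]
  refine integral_congr_ae ?_
  filter_upwards [ht, Lp.coeFn_const (p := 2) (μ := (volume : Measure I)) (1 : ℝ)] with x h1 h2
  rw [h1, h2]
  simp

/-- Bounded jointly measurable functions. The curve is measurable into the separable space `L²`
because its distances to fixed elements are square roots of parametric integrals. -/
lemma of_measurable_of_forall_bound (hf : Measurable (Function.uncurry f)) (C : ℝ)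
    (hC : ∀ t x, |f t x| ≤ C) : IsL2Curve f := by
  have hm : ∀ t, MemLp (f t) 2 (volume : Measure I) := fun t =>
    MemLp.of_bound (hf.comp measurable_prodMk_left).aestronglyMeasurable C
      (ae_of_all _ fun x => hC t x)
  let F : I → L2 := fun t => (hm t).toLp (f t)
  refine ⟨F, ?_, ae_of_all _ fun t => ((hm t).coeFn_toLp).symm⟩
  have hF : AEStronglyMeasurable F (volume : Measure I) := by
    borelize L2
    have : Fact ((2 : ℝ≥0∞) ≠ ∞) := ⟨by norm_num⟩
    refine (measurable_of_measurable_dist fun g => ?_).aestronglyMeasurable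
    have hd : ∀ t, dist (F t) g = √(∫ x, (f t x - g x) * (f t x - g x)) := fun t => by
      rw [dist_eq_norm, norm_eq_sqrt_real_inner, L2.inner_def]
      congr 1
      refine integral_congr_ae ?_
      filter_upwards [Lp.coeFn_sub (F t) g, (hm t).coeFn_toLp] with x h1 h2
      rw [h1, Pi.sub_apply, h2]
      simp [sq]
    simp only [hd]
    have hg : Measurable fun z : I × I => g z.2 :=
      (Lp.stronglyMeasurable g).measurable.comp measurable_snd
    have hfg : Measurable fun z : I × I => (f z.1 z.2 - g z.2) * (f z.1 z.2 - g z.2) :=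
      (hf.sub hg).mul (hf.sub hg)
    exact hfg.stronglyMeasurable.integral_prod_right.measurable.sqrt
  refine MemLp.of_bound hF C (ae_of_all _ fun t => ?_)
  refine (Lp.norm_le_of_ae_bound ((abs_nonneg _).trans (hC 0 0)) (C := C) ?_).trans ?_
  · filter_upwards [(hm t).coeFn_toLp] with x hx
    rw [hx]; exact hC t x
  · simp [measureUnivNNReal]

/-- Variant of `of_measurable_of_forall_bound` with a bound at almost every time only. -/
lemma of_measurable_of_bound (hf : Measurable (Function.uncurry f)) (C : ℝ)
    (hC : ∀ᵐ t : I, ∀ x, |f t x| ≤ C) : IsL2Curve f := by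
  have hcut : IsL2Curve fun t x => max (-|C|) (min (f t x) |C|) := by
    refine of_measurable_of_forall_bound (measurable_const.max (hf.min measurable_const)) |C| ?_
    intro t x
    rw [abs_le]
    exact ⟨le_max_left _ _, max_le (by linarith [abs_nonneg C]) (min_le_right _ _)⟩
  refine hcut.congr ?_
  filter_upwards [hC] with t ht
  refine ae_of_all _ fun x => ?_
  have := abs_le.1 ((ht x).trans (le_abs_self C))
  simp only
  rw [min_eq_left this.2, max_eq_right this.1]

end IsL2Curve

/-! ### Curves along a path -/

lemma continuous_integral_Iic {E : Type*} [NormedAddCommGroup E] [NormedSpace ℝ E]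
    {f : I → E} (hf : Integrable f (volume : Measure I)) :
    Continuous fun t => ∫ s in Iic t, f s := by
  simp only [← integral_indicator measurableSet_Iic]
  refine continuous_iff_continuousAt.2 fun t => ?_
  refine tendsto_integral_filter_of_dominated_convergence (fun s => ‖f s‖) ?_ ?_ hf.norm ?_
  · exact Eventually.of_forall fun u => hf.1.indicator measurableSet_Iic
  · exact Eventually.of_forall fun u => ae_of_all _ fun s => norm_indicator_le_norm_self _ _
  · have hne : ∀ᵐ s : I, s ≠ t := by
      rw [ae_iff]
      simp
    filter_upwards [hne] with s hs
    refine tendsto_const_nhds.congr' ?_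
    rcases lt_or_gt_of_ne hs with h | h
    · filter_upwards [eventually_gt_nhds h] with u hu
      simp [indicator, h.le, hu.le]
    · filter_upwards [eventually_lt_nhds h] with u hu
      simp [indicator, h.not_ge, hu.not_ge]

lemma IsH1.continuous {u du : I → L2} (h : IsH1 u du) : Continuous u := by
  rw [funext h.2]
  exact continuous_const.add (continuous_integral_Iic (h.1.integrable (by norm_num)))

lemma continuous_phi_comp {q : I → L2} (hq : Continuous q) :
    Continuous fun z : Dom => phi (q z.1) z.2 := by
  let E : C(I, C(I, ℝ)) := ContinuousMap.curry ⟨_, continuous_eta_comp hq⟩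
  have h : ∀ z : Dom, phi (q z.1) z.2 =
      inner ℝ (indIic z.2) (ContinuousMap.toLp 2 volume ℝ (E z.1)) := fun z => by
    rw [inner_indIic, phi]
    exact (integral_congr_ae (ae_restrict_of_ae
      (ContinuousMap.coeFn_toLp (p := 2) (𝕜 := ℝ) (volume : Measure I) (E z.1)))).symm
  simp only [h]
  exact (continuous_indIic.comp continuous_snd).inner
    ((ContinuousMap.toLp (E := ℝ) 2 volume ℝ).continuous.comp (E.continuous.comp continuous_fst))

section Along

variable {q : I → L2} {f h : I → I → ℝ}

lemma IsL2Curve.integrable_inEta (hq : Continuous q) (hf : IsL2Curve f) (hh : IsL2Curve h) :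
    Integrable (fun t => inEta (q t) (f t) (h t)) (volume : Measure I) :=
  (hf.continuous_mul (continuous_eta_comp hq)).integrable_integral_mul hh

lemma IsL2Curve.piStar (hq : Continuous q) (hf : IsL2Curve f) :
    IsL2Curve fun t => DiffSpline.piStar (q t) (f t) := by
  have hη := continuous_eta_comp hq
  have hφ := continuous_phi_comp hq
  have h1 : MemLp (fun t => inEta (q t) (f t) fun _ => 1) 2 (volume : Measure I) := by
    simpa [inEta] using hf.memLp_integral_mul_continuous hη
  have h2 : MemLp (fun t => inEta (q t) (f t) (phi (q t))) 2 (volume : Measure I) := by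
    simpa [inEta, mul_right_comm] using hf.memLp_integral_mul_continuous (hη.mul hφ)
  have ha := (h1.const_mul (-4)).add (h2.const_mul 6)
  have hb := (h1.const_mul 6).sub (h2.const_mul 12)
  refine (hf.add ((of_scalar ha).add ((of_scalar hb).continuous_mul hφ))).congr ?_
  refine ae_of_all _ fun t => ae_of_all _ fun x => ?_
  simp only [piStar_apply, Pi.add_apply, Pi.sub_apply]
  ring

end Along

namespace Path

variable (γ : Path)

lemma continuous_q : Continuous γ.q := γ.q_h1.continuous

lemma continuous_etaD : Continuous γ.etaD := continuous_eta_comp γ.continuous_q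

lemma etaD_pos (z : Dom) : 0 < γ.etaD z := eta_pos _ _

/-- The potential `𝒰(p², q)` is continuous in `t`, monotone in `x` and bounded, hence jointly
measurable. -/
lemma isL2Curve_kinetic_potential :
    IsL2Curve fun t => potential (γ.q t) fun z => (γ.p t z) ^ 2 := by
  have hp := γ.p_h1.continuous
  obtain ⟨B, hB, hBc⟩ := exists_continuous_mul_operator γ.continuous_etaD
  have hint : ∀ t, Integrable fun y : I => eta (γ.q t) y * (γ.p t y) ^ 2 := fun t => by
    have := integrable_inEta (q := γ.q t) (memLp_two (γ.p t)) (memLp_two (γ.p t))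
    simpa [sq, mul_assoc] using this
  have hnn : ∀ t (y : I), 0 ≤ eta (γ.q t) y * (γ.p t y) ^ 2 := fun t y =>
    mul_nonneg (eta_pos _ _).le (sq_nonneg _)
  have hcont : ∀ x, Continuous fun t => potential (γ.q t) (fun z => (γ.p t z) ^ 2) x := fun x => by
    let R := LpToLpRestrictCLM I ℝ ℝ (volume : Measure I) 2 (Ici x)
    have hR : ∀ t, potential (γ.q t) (fun z => (γ.p t z) ^ 2) x =
        1 / 2 * inner ℝ (R (B t (γ.p t))) (R (γ.p t)) := fun t => by
      rw [potential, L2.inner_def]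
      congr 1
      refine integral_congr_ae ?_
      filter_upwards [LpToLpRestrictCLM_coeFn ℝ (Ici x) (B t (γ.p t)),
        LpToLpRestrictCLM_coeFn ℝ (Ici x) (γ.p t), ae_restrict_of_ae (hBc t (γ.p t))]
        with y h1 h2 h3
      rw [h1, h2, h3]
      simp only [RCLike.inner_apply, conj_trivial, etaD]
      ring
    simp only [hR]
    exact continuous_const.mul ((R.continuous.comp (hB.clm_apply hp)).inner (R.continuous.comp hp))
  have hanti : ∀ t, Antitone (potential (γ.q t) fun z => (γ.p t z) ^ 2) := fun t x y hxy => by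
    refine mul_le_mul_of_nonneg_left ?_ (by norm_num)
    exact setIntegral_mono_set (hint t).integrableOn (ae_of_all _ (hnn t))
      (Ici_subset_Ici.2 hxy).eventuallyLE
  obtain ⟨C, hC⟩ := isCompact_univ.exists_bound_of_continuousOn (hcont 0).continuousOn
  refine IsL2Curve.of_measurable_of_forall_bound
    (measurable_uncurry_of_continuous_of_measurable hcont fun t => (hanti t).measurable) C ?_
  intro t x
  rw [abs_of_nonneg (mul_nonneg (by norm_num) (integral_nonneg (hnn t)))]
  exact (hanti t unitInterval.nonneg').trans ((le_abs_self _).trans (hC t trivial))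

lemma isL2Curve_accFlat : IsL2Curve γ.accFlat :=
  ((IsL2Curve.of_memLp γ.p_h1.1).add γ.isL2Curve_kinetic_potential).piStar γ.continuous_q

end Path

/-! ### Time marginals and time slices -/

lemma abs_signedIntegral_le (δ : SignedMeasure Dom) (f : C(Dom, ℝ)) {M : ℝ}
    (hM : ∀ z, |f z| ≤ M) :
    |signedIntegral δ f| ≤ M * (δ.toJordanDecomposition.posPart.real univ +
      δ.toJordanDecomposition.negPart.real univ) := by
  have h : ∀ (μ : Measure Dom) [IsFiniteMeasure μ], |∫ z, f z ∂μ| ≤ M * μ.real univ := fun μ _ =>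
    norm_integral_le_of_norm_le_const (μ := μ) (f := f) (ae_of_all _ hM)
  rw [signedIntegral, mul_add]
  exact (abs_sub _ _).trans (add_le_add (h _) (h _))

/-- The test function `f(t, x) = - ∫_t^1 h`, whose time derivative is `h`. -/
lemma exists_testFunction (h : C(I, ℝ)) (hh : ∀ t, 0 ≤ h t) :
    ∃ f df : C(Dom, ℝ), IsC10 f df ∧ (∀ x : I, f (1, x) = 0) ∧ (∀ z, df z = h z.1) ∧
      ∀ z, |f z| ≤ ∫ t : I, h t := by
  have hint : Integrable h (volume : Measure I) := integrable_of_continuous h.continuous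
  let f : C(Dom, ℝ) := ⟨fun z => (∫ s in Iic z.1, h s) - ∫ s, h s,
    ((continuous_integral_Iic hint).comp continuous_fst).sub continuous_const⟩
  refine ⟨f, h.comp ⟨Prod.fst, continuous_fst⟩, ?_, ?_, fun z => rfl, ?_⟩
  · intro t x
    set e : ℝ → ℝ := fun s => h (projIcc 0 1 zero_le_one s)
    have he : Continuous e := h.continuous.comp continuous_projIcc
    have hd : HasDerivAt (fun s : ℝ => (∫ u in (0 : ℝ)..s, e u) - ∫ s, h s) (e t) t :=
      (he.integral_hasStrictDerivAt 0 t).hasDerivAt.sub_const _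
    have het : e t = h t := by simp [e]
    rw [het] at hd
    refine hd.hasDerivWithinAt.congr_of_mem (fun s hs => ?_) t.2
    simp only [f, ContinuousMap.coe_mk, setIntegral_Iic_eq, projIcc_of_mem _ hs, e]
  · intro x
    have : Iic (1 : I) = univ := by
      ext y
      simp [unitInterval.le_one']
    simp [f, this]
  · intro z
    have h1 : ∫ s in Iic z.1, h s ≤ ∫ s, h s :=
      setIntegral_le_integral hint (ae_of_all _ hh)
    have h2 : 0 ≤ ∫ s in Iic z.1, h s := integral_nonneg hh
    simp only [f, ContinuousMap.coe_mk]
    rw [abs_le]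
    constructor <;> linarith

/-- A finite measure is bounded by `μ` as soon as this holds against nonnegative continuous
functions. -/
lemma measure_le_of_forall_integral_le {ν μ : Measure I} [IsFiniteMeasure ν] [IsFiniteMeasure μ]
    (h : ∀ f : C(I, ℝ), (∀ t, 0 ≤ f t) → ∫ t, f t ∂ν ≤ ∫ t, f t ∂μ) : ν ≤ μ := by
  have hclosed : ∀ F : Set I, IsClosed F → ν F ≤ μ F := fun F hF => by
    refine le_of_tendsto_of_tendsto' (HasOuterApproxClosed.tendsto_lintegral_apprSeq hF ν)
      (HasOuterApproxClosed.tendsto_lintegral_apprSeq hF μ) fun n => ?_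
    let a : C(I, ℝ) := ⟨fun t => (hF.apprSeq n t : ℝ), by fun_prop⟩
    have ha : ∀ κ : Measure I, IsFiniteMeasure κ →
        ∫⁻ t, (hF.apprSeq n t : ℝ≥0∞) ∂κ = ENNReal.ofReal (∫ t, a t ∂κ) := fun κ _ => by
      rw [ofReal_integral_eq_lintegral_ofReal (integrable_of_continuous a.continuous)
        (ae_of_all _ fun t => NNReal.coe_nonneg _)]
      simp [a]
    rw [ha ν inferInstance, ha μ inferInstance]
    exact ENNReal.ofReal_le_ofReal (h a fun t => NNReal.coe_nonneg _)
  refine Measure.le_iff.2 fun s hs => ?_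
  rw [hs.measure_eq_iSup_isClosed_of_ne_top (measure_ne_top ν s)]
  refine iSup₂_le fun F hFs => iSup_le fun hF => ?_
  exact (hclosed F hF).trans (measure_mono hFs)

/-- If `∂_t Δ` is a finite measure, then the time marginal of `Δ` has a bounded density: the mass of
`Δ_t` is a function of bounded variation vanishing at `t = 0`. -/
lemma IsTimeDeriv.fst_le {Δ : FiniteMeasure Dom} {δ : SignedMeasure Dom} (h : IsTimeDeriv Δ δ) :
    ∃ C : ℝ≥0, (Δ : Measure Dom).fst ≤ C • (volume : Measure I) := by
  set C : ℝ := δ.toJordanDecomposition.posPart.real univ +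
      δ.toJordanDecomposition.negPart.real univ
  have hC : 0 ≤ C := add_nonneg measureReal_nonneg measureReal_nonneg
  refine ⟨C.toNNReal, measure_le_of_forall_integral_le fun f hf => ?_⟩
  -- Testing with `g(t, x) = - ∫_t^1 f` gives `∫ f dΔ = - ⟨g, δ⟩ ≤ |δ|(D) ∫ f`.
  obtain ⟨g, dg, hg, hg1, hdg, hgb⟩ := exists_testFunction f hf
  have h1 := h g dg hg hg1
  have h2 := abs_signedIntegral_le δ g hgb
  have h3 : ∫ t, f t ∂(Δ : Measure Dom).fst = ∫ z, dg z ∂(Δ : Measure Dom) := by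
    rw [Measure.fst, integral_map measurable_fst.aemeasurable f.continuous.aestronglyMeasurable]
    simp [hdg]
  rw [h3, integral_smul_nnreal_measure, NNReal.smul_def, Real.coe_toNNReal _ hC, smul_eq_mul,
    mul_comm]
  linarith [(abs_le.1 h2).1]

section Slice

/-- Stated for the measurable space underlying `volume` on `[0,1]`, which instance search does not
identify with the subtype structure carried by the marginals of measures on `D`. -/
instance haveLebesgueDecomposition_volume (ν : Measure I) [SFinite ν] :
    ν.HaveLebesgueDecomposition (volume : Measure I) :=
  Measure.haveLebesgueDecomposition_of_sigmaFinite _ _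

variable {Δ : FiniteMeasure Dom} {C : ℝ≥0}

lemma fst_absolutelyContinuous (hC : (Δ : Measure Dom).fst ≤ C • (volume : Measure I)) :
    (Δ : Measure Dom).fst ≪ (volume : Measure I) :=
  (Measure.absolutelyContinuous_of_le hC).trans (Measure.smul_absolutelyContinuous)

lemma rnDeriv_fst_le (hC : (Δ : Measure Dom).fst ≤ C • (volume : Measure I)) :
    ∀ᵐ t : I, (Δ : Measure Dom).fst.rnDeriv volume t ≤ C := by
  refine ae_le_of_forall_setLIntegral_le_of_sigmaFinite (Measure.measurable_rnDeriv _ _) ?_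
  intro s _ _
  rw [setLIntegral_const]
  exact (Measure.setLIntegral_rnDeriv_le s).trans (hC s)

lemma slice_univ_le (hC : (Δ : Measure Dom).fst ≤ C • (volume : Measure I)) :
    ∀ᵐ t : I, slice Δ t univ ≤ C := by
  filter_upwards [rnDeriv_fst_le hC] with t ht
  simpa [slice] using ht

lemma isFiniteMeasure_slice (hC : (Δ : Measure Dom).fst ≤ C • (volume : Measure I)) :
    ∀ᵐ t : I, IsFiniteMeasure (slice Δ t) := by
  filter_upwards [slice_univ_le hC] with t ht
  exact ⟨ht.trans_lt ENNReal.coe_lt_top⟩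

lemma integral_slice (Δ : FiniteMeasure Dom) (t : I) (f : I → ℝ) :
    ∫ x, f x ∂slice Δ t = ((Δ : Measure Dom).fst.rnDeriv volume t).toReal *
      ∫ x, f x ∂(Δ : Measure Dom).condKernel t := by
  rw [slice, integral_smul_measure, smul_eq_mul]

lemma integrable_integral_slice (hC : (Δ : Measure Dom).fst ≤ C • (volume : Measure I))
    {h : Dom → ℝ} (hh : Continuous h) :
    Integrable (fun t => ∫ x, h (t, x) ∂slice Δ t) (volume : Measure I) := by
  simp only [integral_slice]
  have hint : Integrable h ((Δ : Measure Dom).fst.compProd (Δ : Measure Dom).condKernel) := by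
    rw [Measure.disintegrate]
    exact integrable_of_continuous hh
  have := (integrable_rnDeriv_smul_iff (fst_absolutelyContinuous hC)).2 hint.integral_compProd
  simp only [smul_eq_mul, ProbabilityTheory.Kernel.prodMkLeft_apply] at this
  exact this

/-- Time disintegration of integrals. -/
lemma integral_integral_slice (hC : (Δ : Measure Dom).fst ≤ C • (volume : Measure I))
    {h : Dom → ℝ} (hh : Continuous h) :
    ∫ t : I, ∫ x, h (t, x) ∂slice Δ t = ∫ z, h z ∂(Δ : Measure Dom) := by
  simp only [integral_slice]
  rw [← Measure.integral_condKernel (integrable_of_continuous hh),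
    ← integral_rnDeriv_smul (fst_absolutelyContinuous hC)]
  simp only [smul_eq_mul]

lemma potentialMeasure_slice (q : L2) (t x : I) :
    potentialMeasure q (slice Δ t) x = 1 / 2 * (((Δ : Measure Dom).fst.rnDeriv volume t).toReal *
      ∫ y in Ici x, eta q y ∂(Δ : Measure Dom).condKernel t) := by
  rw [potentialMeasure, slice, Measure.restrict_smul, integral_smul_measure, smul_eq_mul]

/-- The potential of a measure with bounded time density is bounded. -/
lemma isL2Curve_potentialMeasure {q : I → L2} (hq : Continuous q)
    (hC : (Δ : Measure Dom).fst ≤ C • (volume : Measure I)) :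
    IsL2Curve fun t => potentialMeasure (q t) (slice Δ t) := by
  have hη := continuous_eta_comp hq
  obtain ⟨M, hM⟩ := isCompact_univ.exists_bound_of_continuousOn hη.continuousOn
  refine IsL2Curve.of_measurable_of_bound ?_ (1 / 2 * (C * M)) ?_
  · have hs : MeasurableSet {w : (I × I) × I | w.1.2 ≤ w.2} :=
      measurableSet_le (measurable_snd.comp measurable_fst) measurable_snd
    have hηm : Measurable fun w : (I × I) × I => eta (q w.1.1) w.2 :=
      (hη.comp (by fun_prop : Continuous fun w : (I × I) × I => (w.1.1, w.2))).measurable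
    let κ : ProbabilityTheory.Kernel (I × I) I :=
      ((Δ : Measure Dom).condKernel).comap (Prod.fst : I × I → I) measurable_fst
    have hk := (hηm.indicator hs).stronglyMeasurable.integral_kernel_prod_right' (κ := κ)
    have heq : Function.uncurry (fun t => potentialMeasure (q t) (slice Δ t)) = fun z : I × I =>
        1 / 2 * (((Δ : Measure Dom).fst.rnDeriv volume z.1).toReal *
          ∫ y, {w : (I × I) × I | w.1.2 ≤ w.2}.indicator (fun w => eta (q w.1.1) w.2) (z, y) ∂κ z) := by
      ext ⟨t, x⟩
      simp only [Function.uncurry, potentialMeasure_slice, κ,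
        ProbabilityTheory.Kernel.comap_apply, ← integral_indicator measurableSet_Ici]
      rfl
    rw [heq]
    exact (((Measure.measurable_rnDeriv _ _).comp measurable_fst).ennreal_toReal.mul
      hk.measurable).const_mul _
  · filter_upwards [slice_univ_le hC, isFiniteMeasure_slice hC] with t ht _ x
    rw [potentialMeasure, abs_mul, abs_of_pos (by norm_num : (0 : ℝ) < 1 / 2)]
    refine mul_le_mul_of_nonneg_left ?_ (by norm_num)
    have hM0 : 0 ≤ M := (norm_nonneg _).trans (hM (0, 0) trivial)
    have h1 : (slice Δ t).real (Ici x) ≤ C := by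
      refine (measureReal_mono (subset_univ _)).trans ?_
      exact ENNReal.toReal_mono ENNReal.coe_ne_top ht
    have h2 : ‖∫ y in Ici x, eta (q t) y ∂slice Δ t‖ ≤ M * (slice Δ t).real (Ici x) := by
      refine (norm_setIntegral_le_of_norm_le_const (measure_lt_top _ _) fun y _ => ?_)
      exact hM (t, y) trivial
    calc |∫ y in Ici x, eta (q t) y ∂slice Δ t| ≤ M * (slice Δ t).real (Ici x) := h2
      _ ≤ C * M := by rw [mul_comm]; gcongr

/-- Slices are homogeneous, by uniqueness of the disintegration. -/
lemma slice_smul (hC : (Δ : Measure Dom).fst ≤ C • (volume : Measure I)) (a : ℝ≥0) :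
    ∀ᵐ t : I, slice (a • Δ) t = a • slice Δ t := by
  have hcoe : ((a • Δ : FiniteMeasure Dom) : Measure Dom) = a • (Δ : Measure Dom) :=
    FiniteMeasure.toMeasure_smul a Δ
  have hfst : ((a • Δ : FiniteMeasure Dom) : Measure Dom).fst = a • (Δ : Measure Dom).fst := by
    rw [hcoe, Measure.fst, Measure.fst, Measure.map_smul]
  have hac : ((a • Δ : FiniteMeasure Dom) : Measure Dom).fst ≪ (volume : Measure I) := by
    rw [hfst]
    exact Measure.smul_absolutelyContinuous.trans (fst_absolutelyContinuous hC)
  have hrn := Measure.rnDeriv_smul_left (Δ : Measure Dom).fst (volume : Measure I) a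
  have hcond := ProbabilityTheory.eq_condKernel_of_measure_eq_compProd
    (ρ := ((a • Δ : FiniteMeasure Dom) : Measure Dom)) (Δ : Measure Dom).condKernel (by
      have h := Measure.compProd_smul_left (μ := (Δ : Measure Dom).fst)
        (κ := (Δ : Measure Dom).condKernel) (a : ℝ≥0∞)
      rw [Measure.disintegrate] at h
      rw [hfst, hcoe]
      exact h.symm)
  rw [← Measure.withDensity_rnDeriv_eq _ _ hac,
    ae_withDensity_iff (Measure.measurable_rnDeriv _ _)] at hcond
  -- The conditional kernels agree where the density of the time marginal is nonzero; elsewhere both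
  -- slices vanish.
  filter_upwards [hrn, hcond] with t h1 h2
  rw [← hfst] at h1
  by_cases h0 : ((a • Δ : FiniteMeasure Dom) : Measure Dom).fst.rnDeriv volume t = 0
  · rw [slice, slice, h0, zero_smul, ← smul_assoc]
    rw [h0] at h1
    rw [Pi.smul_apply] at h1
    rw [← h1, zero_smul]
  · rw [slice, slice, ← h2 h0, h1, Pi.smul_apply, smul_assoc]

lemma potentialMeasure_smul (q : L2) (ν : Measure I) (a : ℝ≥0) (x : I) :
    potentialMeasure q (a • ν) x = a * potentialMeasure q ν x := by
  rw [potentialMeasure, potentialMeasure, Measure.restrict_smul, integral_smul_nnreal_measure,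
    NNReal.smul_def, smul_eq_mul]
  ring

end Slice

/-! ### Duality for the Fisher-Rao functional -/

/-- Young's inequality `e b² / (4 a) ≥ b g - a g² / e` for the integrand `r`; where `r` is infinite
there is nothing to prove. -/
lemma ofReal_le_r_mul {e : ℝ} (he : 0 < e) (a b g : ℝ) :
    ENNReal.ofReal (b * g - a * (1 / e * g ^ 2)) ≤ r a b * ENNReal.ofReal e := by
  rw [r]
  split_ifs with h1 h2
  · rw [← ENNReal.ofReal_mul (by positivity)]
    refine ENNReal.ofReal_le_ofReal ?_
    have h : b ^ 2 / (4 * a) * e - (b * g - a * (1 / e * g ^ 2)) =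
        (b * e - 2 * a * g) ^ 2 / (4 * a * e) := by
      field_simp
      ring
    have : 0 ≤ (b * e - 2 * a * g) ^ 2 / (4 * a * e) := by positivity
    linarith
  · simp [h2.1, h2.2]
  · rw [ENNReal.top_mul (by simpa using he)]
    exact le_top

/-- The Fisher-Rao functional dominates its dual expression at every test function. -/
lemma ofReal_signedIntegral_sub_le_FR {e : Dom → ℝ} (he : Continuous e) (hpos : ∀ z, 0 < e z)
    (Δ : FiniteMeasure Dom) (δ : SignedMeasure Dom) (g : C(Dom, ℝ)) :
    ENNReal.ofReal (signedIntegral δ g - ∫ z, 1 / e z * g z ^ 2 ∂(Δ : Measure Dom)) ≤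
      FR e Δ δ := by
  set lam : Measure Dom := (Δ : Measure Dom) + δ.totalVariation with hlam
  set j := δ.toJordanDecomposition
  have hΔ : (Δ : Measure Dom) ≪ lam :=
    Measure.absolutelyContinuous_of_le (Measure.le_add_right le_rfl)
  have hp : j.posPart ≪ lam := Measure.absolutelyContinuous_of_le
    (Measure.le_add_left (Measure.le_add_right le_rfl))
  have hn : j.negPart ≪ lam := Measure.absolutelyContinuous_of_le
    (Measure.le_add_left (Measure.le_add_left le_rfl))
  have hlamfin : IsFiniteMeasure lam := by
    rw [hlam, SignedMeasure.totalVariation]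
    infer_instance
  have hc : Continuous fun z => 1 / e z * g z ^ 2 :=
    (continuous_const.div he fun z => (hpos z).ne').mul (g.continuous.pow 2)
  have hi : ∀ (μ : Measure Dom) [IsFiniteMeasure μ] (f : Dom → ℝ), Continuous f → μ ≪ lam →
      Integrable (fun z => (μ.rnDeriv lam z).toReal * f z) lam := fun μ _ f hf hμ => by
    have := Measure.haveLebesgueDecomposition_of_sigmaFinite μ lam
    have := (integrable_rnDeriv_smul_iff hμ).2 (integrable_of_continuous (μ := μ) hf)
    simpa only [smul_eq_mul] using this
  have hI : ∀ (μ : Measure Dom) [IsFiniteMeasure μ] (f : Dom → ℝ), μ ≪ lam →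
      ∫ z, (μ.rnDeriv lam z).toReal * f z ∂lam = ∫ z, f z ∂μ := fun μ _ f hμ => by
    have := Measure.haveLebesgueDecomposition_of_sigmaFinite μ lam
    exact integral_rnDeriv_smul hμ
  have hip := hi j.posPart g g.continuous hp
  have hin := hi j.negPart g g.continuous hn
  have hic := hi Δ _ hc hΔ
  have hipn : Integrable (fun z => (j.posPart.rnDeriv lam z).toReal * g z -
      (j.negPart.rnDeriv lam z).toReal * g z) lam := hip.sub hin
  have hb : ∀ z, δ.rnDeriv lam z * g z = (j.posPart.rnDeriv lam z).toReal * g z -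
      (j.negPart.rnDeriv lam z).toReal * g z := fun z => sub_mul _ _ _
  have hval : signedIntegral δ g - ∫ z, 1 / e z * g z ^ 2 ∂(Δ : Measure Dom) =
      ∫ z, (δ.rnDeriv lam z * g z -
        ((Δ : Measure Dom).rnDeriv lam z).toReal * (1 / e z * g z ^ 2)) ∂lam := by
    simp only [hb]
    rw [integral_sub hipn hic, integral_sub hip hin, hI _ _ hp, hI _ _ hn, hI _ _ hΔ]
    rfl
  have hint : Integrable (fun z => δ.rnDeriv lam z * g z -
      ((Δ : Measure Dom).rnDeriv lam z).toReal * (1 / e z * g z ^ 2)) lam := by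
    simp only [hb]
    exact hipn.sub hic
  rw [hval]
  refine (ENNReal.ofReal_le_ofReal
    (integral_mono hint hint.pos_part fun z => le_max_left _ _)).trans ?_
  rw [ofReal_integral_eq_lintegral_ofReal hint.pos_part (ae_of_all _ fun z => le_max_right _ _)]
  refine lintegral_mono fun z => ?_
  rw [ENNReal.ofReal_max, ENNReal.ofReal_zero, max_eq_left zero_le]
  exact ofReal_le_r_mul (hpos z) _ _ _

/-! ### The quadratic functional `𝒢` -/

namespace Path

variable (γ : Path) {P : L2 → L2 → ℝ} {Δ Δ' : FiniteMeasure Dom} {C C' : ℝ≥0}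

/-- The covector `(D/Dt dq/dt)^♭ + π_q^*(𝒰(Δ, q))` whose square norm is integrated in `𝒢`. -/
noncomputable def residual (Δ : FiniteMeasure Dom) (t x : I) : ℝ :=
  γ.accFlat t x + γ.projPotential Δ t x

/-- Half the directional derivative `⟨D𝒢(Δ), ν⟩`, written as the integral in time of the product of the
residual of `Δ` with `π_q^*(𝒰(ν, q))`. -/
noncomputable def linearPart (Δ ν : FiniteMeasure Dom) : ℝ :=
  ∫ t : I, inEta (γ.q t) (γ.residual Δ t) (γ.projPotential ν t)

lemma G_eq (P : L2 → L2 → ℝ) (Δ : FiniteMeasure Dom) :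
    γ.G P Δ = (∫ t : I, inEta (γ.q t) (γ.residual Δ t) (γ.residual Δ t)) + P (γ.p 1) (γ.q 1) := rfl

lemma isL2Curve_projPotential (hC : (Δ : Measure Dom).fst ≤ C • (volume : Measure I)) :
    IsL2Curve (γ.projPotential Δ) :=
  (isL2Curve_potentialMeasure γ.continuous_q hC).piStar γ.continuous_q

lemma isL2Curve_residual (hC : (Δ : Measure Dom).fst ≤ C • (volume : Measure I)) :
    IsL2Curve (γ.residual Δ) :=
  γ.isL2Curve_accFlat.add (γ.isL2Curve_projPotential hC)

/-- Along the ray through `Δ`, the functional `𝒢` is a quadratic polynomial. -/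
lemma G_add_smul_self (hC : (Δ : Measure Dom).fst ≤ C • (volume : Measure I)) {s : ℝ}
    (hs : 0 ≤ s) :
    γ.G P (Δ + s.toNNReal • Δ) = γ.G P Δ + 2 * s * γ.linearPart Δ Δ +
      s ^ 2 * ∫ t : I, inEta (γ.q t) (γ.projPotential Δ t) (γ.projPotential Δ t) := by
  have hsum : Δ + s.toNNReal • Δ = (1 + s.toNNReal) • Δ := by rw [add_smul, one_smul]
  have hv := γ.isL2Curve_residual hC
  have hu := γ.isL2Curve_projPotential hC
  have hres : ∀ᵐ t : I, γ.residual (Δ + s.toNNReal • Δ) t =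
      fun x => γ.residual Δ t x + s * γ.projPotential Δ t x := by
    filter_upwards [slice_smul hC (1 + s.toNNReal)] with t ht
    ext x
    have hpot : potentialMeasure (γ.q t) (slice ((1 + s.toNNReal) • Δ) t) =
        fun x => (1 + s) * potentialMeasure (γ.q t) (slice Δ t) x := by
      ext x
      rw [ht, potentialMeasure_smul]
      simp [Real.coe_toNNReal _ hs]
    simp only [residual, projPotential, hsum, hpot, piStar_smul]
    ring
  have hexp : ∀ᵐ t : I, inEta (γ.q t) (γ.residual (Δ + s.toNNReal • Δ) t)
      (γ.residual (Δ + s.toNNReal • Δ) t) =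
      inEta (γ.q t) (γ.residual Δ t) (γ.residual Δ t) +
      2 * s * inEta (γ.q t) (γ.residual Δ t) (γ.projPotential Δ t) +
      s ^ 2 * inEta (γ.q t) (γ.projPotential Δ t) (γ.projPotential Δ t) := by
    filter_upwards [hres, hv.memLp, hu.memLp] with t h1 h2 h3
    rw [h1, inEta_add_smul_self h2 h3]
  have i1 := hv.integrable_inEta γ.continuous_q hv
  have i2 := (hv.integrable_inEta γ.continuous_q hu).const_mul (2 * s)
  have i12 : Integrable (fun t => inEta (γ.q t) (γ.residual Δ t) (γ.residual Δ t) +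
      2 * s * inEta (γ.q t) (γ.residual Δ t) (γ.projPotential Δ t)) (volume : Measure I) :=
    i1.add i2
  have i3 := (hu.integrable_inEta γ.continuous_q hu).const_mul (s ^ 2)
  rw [G_eq, G_eq, integral_congr_ae hexp, integral_add i12 i3, integral_add i1 i2,
    integral_const_mul, integral_const_mul, linearPart]
  ring

/-- The derivative of `𝒢` at `Δ` in the direction `Δ`. -/
lemma DG_self (hC : (Δ : Measure Dom).fst ≤ C • (volume : Measure I)) :
    γ.DG P Δ Δ = 2 * γ.linearPart Δ Δ := by
  set K := ∫ t : I, inEta (γ.q t) (γ.projPotential Δ t) (γ.projPotential Δ t) with hK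
  have hd : HasDerivAt (fun s : ℝ => γ.G P Δ + 2 * s * γ.linearPart Δ Δ + s ^ 2 * K)
      (2 * γ.linearPart Δ Δ) 0 := by
    have h := ((((hasDerivAt_id (0 : ℝ)).const_mul 2).mul_const (γ.linearPart Δ Δ)).const_add
      (γ.G P Δ)).add (((hasDerivAt_id (0 : ℝ)).pow 2).mul_const K)
    refine h.congr_deriv ?_
    simp
  refine HasDerivWithinAt.derivWithin ?_ (uniqueDiffOn_Ici 0 0 self_mem_Ici)
  exact hd.hasDerivWithinAt.congr_of_mem (fun s hs => γ.G_add_smul_self hC hs) self_mem_Ici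

/-- Convexity: `𝒢` lies above its linearization at `Δ`. -/
lemma G_sub_le (hC : (Δ : Measure Dom).fst ≤ C • (volume : Measure I))
    (hC' : (Δ' : Measure Dom).fst ≤ C' • (volume : Measure I)) :
    2 * γ.linearPart Δ Δ' - 2 * γ.linearPart Δ Δ ≤ γ.G P Δ' - γ.G P Δ := by
  have hv := γ.isL2Curve_residual hC
  have hu := γ.isL2Curve_projPotential hC
  have hv' := γ.isL2Curve_residual hC'
  have hu' := γ.isL2Curve_projPotential hC'
  have hle : ∀ᵐ t : I, 2 * inEta (γ.q t) (γ.residual Δ t) (γ.projPotential Δ' t) -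
      2 * inEta (γ.q t) (γ.residual Δ t) (γ.projPotential Δ t) ≤
      inEta (γ.q t) (γ.residual Δ' t) (γ.residual Δ' t) -
        inEta (γ.q t) (γ.residual Δ t) (γ.residual Δ t) := by
    filter_upwards [hv.memLp, hu.memLp, hu'.memLp] with t h1 h2 h3
    have h4 : MemLp (fun x => γ.projPotential Δ' t x + (-1) * γ.projPotential Δ t x) 2
        (volume : Measure I) := h3.add (h2.const_mul (-1))
    have h5 : γ.residual Δ' t = fun x => γ.residual Δ t x +
        1 * (γ.projPotential Δ' t x + (-1) * γ.projPotential Δ t x) := by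
      ext x
      simp only [residual]
      ring
    rw [h5, inEta_add_smul_self h1 h4, inEta_add_right h3 (h2.const_mul (-1)) h1, inEta_smul_right]
    have := inEta_self_nonneg (γ.q t)
      (fun x => γ.projPotential Δ' t x + (-1) * γ.projPotential Δ t x)
    linarith
  have i1 := hv.integrable_inEta γ.continuous_q hv
  have i1' := hv'.integrable_inEta γ.continuous_q hv'
  have i2 := (hv.integrable_inEta γ.continuous_q hu).const_mul 2
  have i2' := (hv.integrable_inEta γ.continuous_q hu').const_mul 2
  have := integral_mono_ae (i2'.sub i2) (i1'.sub i1) hle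
  simp only [Pi.sub_apply] at this
  rw [integral_sub i2' i2, integral_sub i1' i1, integral_const_mul, integral_const_mul] at this
  rw [G_eq, G_eq, linearPart, linearPart]
  linarith

/-- The right-hand side of the Riccati inequality represents the linear part of `𝒢`: since the
residual lies in the range of the projection, the projection of the potential can be dropped, and
the order of integration in the potential can be exchanged. -/
lemma integral_riccatiRhs (hC : (Δ : Measure Dom).fst ≤ C • (volume : Measure I)) :
    ∀ᵐ t : I, Continuous (γ.riccatiRhs Δ t) ∧ ∀ (ν : Measure I) [IsFiniteMeasure ν],
      MemLp (potentialMeasure (γ.q t) ν) 2 (volume : Measure I) →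
      ∫ x, γ.riccatiRhs Δ t x ∂ν =
        2 * inEta (γ.q t) (γ.residual Δ t) (piStar (γ.q t) (potentialMeasure (γ.q t) ν)) := by
  have hw := (IsL2Curve.of_memLp γ.p_h1.1).add γ.isL2Curve_kinetic_potential
  filter_upwards [hw.memLp, (isL2Curve_potentialMeasure γ.continuous_q hC).memLp,
    (γ.isL2Curve_residual hC).memLp] with t h1 h2 h3
  have hR : γ.riccatiRhs Δ t = fun x => eta (γ.q t) x *
      (∫ y in Iic x, eta (γ.q t) y * γ.residual Δ t y) := by
    ext x
    simp only [riccatiRhs, acc, residual, mul_add]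
  have hres : γ.residual Δ t = piStar (γ.q t) (fun x => (γ.dp t x +
      potential (γ.q t) (fun z => (γ.p t z) ^ 2) x) + potentialMeasure (γ.q t) (slice Δ t) x) := by
    rw [piStar_add h1 h2]
    rfl
  have h12 : MemLp (fun x => (γ.dp t x + potential (γ.q t) (fun z => (γ.p t z) ^ 2) x) +
      potentialMeasure (γ.q t) (slice Δ t) x) 2 (volume : Measure I) := h1.add h2
  refine ⟨?_, fun ν _ hν => ?_⟩
  · rw [hR]
    exact (continuous_eta _).mul (continuous_integral_Iic
      ((memLp_continuous_mul (continuous_eta _) h3).integrable (by norm_num)))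
  · rw [hR, ← inEta_potentialMeasure h3 ν, hres, inEta_piStar_piStar (γ.q_mem t) h12 hν]

/-- Integrating the Riccati inequality against `Δ'`. -/
lemma integral_le_linearPart (hC : (Δ : Measure Dom).fst ≤ C • (volume : Measure I))
    (hC' : (Δ' : Measure Dom).fst ≤ C' • (volume : Measure I)) {g dg : C(Dom, ℝ)}
    (hg : ∀ᵐ t : I, ∀ x : I,
      dg (t, x) + 1 / γ.etaD (t, x) * g (t, x) ^ 2 ≤ γ.riccatiRhs Δ t x) :
    ∫ z, dg z ∂(Δ' : Measure Dom) + ∫ z, 1 / γ.etaD z * g z ^ 2 ∂(Δ' : Measure Dom) ≤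
      2 * γ.linearPart Δ Δ' := by
  have hc : Continuous fun z => 1 / γ.etaD z * g z ^ 2 :=
    (continuous_const.div γ.continuous_etaD fun z => (γ.etaD_pos z).ne').mul (g.continuous.pow 2)
  have hs : Continuous fun z => dg z + 1 / γ.etaD z * g z ^ 2 := dg.continuous.add hc
  rw [← integral_add (integrable_of_continuous dg.continuous) (integrable_of_continuous hc),
    ← integral_integral_slice hC' hs, linearPart, ← integral_const_mul]
  refine integral_mono_ae (integrable_integral_slice hC' hs)
    (((γ.isL2Curve_residual hC).integrable_inEta γ.continuous_q
      (γ.isL2Curve_projPotential hC')).const_mul 2) ?_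
  filter_upwards [hg, γ.integral_riccatiRhs hC, isFiniteMeasure_slice hC',
    (isL2Curve_potentialMeasure γ.continuous_q hC').memLp] with t h1 h2 h3 h4
  refine le_trans ?_ (h2.2 (slice Δ' t) h4).le
  exact integral_mono (integrable_of_continuous (hs.comp (Continuous.prodMk_right t)))
    (integrable_of_continuous h2.1) h1

/-- A subsolution of the Riccati equation bounds the Fisher-Rao functional from below. -/
lemma ofReal_neg_linearPart_le_FRdt (hC : (Δ : Measure Dom).fst ≤ C • (volume : Measure I))
    {g dg : C(Dom, ℝ)} (hgd : IsC10 g dg) (hg1 : ∀ x : I, g (1, x) = 0)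
    (hg : ∀ᵐ t : I, ∀ x : I,
      dg (t, x) + 1 / γ.etaD (t, x) * g (t, x) ^ 2 ≤ γ.riccatiRhs Δ t x) :
    ENNReal.ofReal (-(2 * γ.linearPart Δ Δ')) ≤ FRdt γ.etaD Δ' := by
  refine le_iInf₂ fun δ hδ => ?_
  obtain ⟨C', hC'⟩ := hδ.fst_le
  refine le_trans (ENNReal.ofReal_le_ofReal ?_)
    (ofReal_signedIntegral_sub_le_FR γ.continuous_etaD γ.etaD_pos Δ' δ g)
  have h1 := γ.integral_le_linearPart hC hC' hg
  have h2 := hδ g dg hgd hg1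
  linarith

end Path

/-- A finite Fisher-Rao value forces `∂_t Δ` to be a finite measure, so the marginal density is
bounded. -/
lemma exists_fst_le_of_FRdt_ne_top {e : Dom → ℝ} {Δ : FiniteMeasure Dom} (h : FRdt e Δ ≠ ⊤) :
    ∃ C : ℝ≥0, (Δ : Measure Dom).fst ≤ C • (volume : Measure I) := by
  have hlt : FRdt e Δ < ⊤ := lt_top_iff_ne_top.2 h
  simp only [FRdt, iInf_lt_iff] at hlt
  obtain ⟨δ, hδ, -⟩ := hlt
  exact hδ.fst_le

end DiffSpline

theorem mainTheorem3 (γ : DiffSpline.Path) (P : DiffSpline.L2 → DiffSpline.L2 → ℝ)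
    (Δ : FiniteMeasure DiffSpline.Dom) (hΔ : Δ ∈ DiffSpline.M0)
    (hRiccati : ∃ g dg : C(DiffSpline.Dom, ℝ), DiffSpline.IsC10 g dg ∧ (∀ x : I, g (1, x) = 0) ∧
      ∀ᵐ t : I, ∀ x : I,
        dg (t, x) + 1 / γ.etaD (t, x) * g (t, x) ^ 2 ≤ γ.riccatiRhs Δ t x)
    (hEq : ((-γ.DG P Δ Δ : ℝ) : EReal) = (DiffSpline.FRdt γ.etaD Δ : EReal)) :
    IsMinOn (γ.F P) DiffSpline.M0 Δ := by
  obtain ⟨g, dg, hgd, hg1, hg⟩ := hRiccati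
  refine isMinOn_iff.2 fun Δ' _ => ?_
  by_cases htop : DiffSpline.FRdt γ.etaD Δ' = ⊤
  · rw [DiffSpline.Path.F, DiffSpline.Path.F, htop, EReal.coe_ennreal_top, EReal.top_add_coe]
    exact le_top
  have hfin : DiffSpline.FRdt γ.etaD Δ ≠ ⊤ := fun h => by
    rw [h, EReal.coe_ennreal_top] at hEq
    exact EReal.coe_ne_top _ hEq
  obtain ⟨C, hC⟩ := DiffSpline.exists_fst_le_of_FRdt_ne_top hfin
  obtain ⟨C', hC'⟩ := DiffSpline.exists_fst_le_of_FRdt_ne_top htop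
  have hFR := γ.ofReal_neg_linearPart_le_FRdt (Δ' := Δ') hC hgd hg1 hg
  have hconv := γ.G_sub_le (P := P) hC hC'
  rw [γ.DG_self hC] at hEq
  rw [ENNReal.ofReal_le_iff_le_toReal htop] at hFR
  -- All terms are finite here, so the comparison takes place in `ℝ`.
  rw [DiffSpline.Path.F, DiffSpline.Path.F, ← hEq, ← EReal.coe_ennreal_toReal htop,
    ← EReal.coe_add, ← EReal.coe_add, EReal.coe_le_coe_iff]
  linarith
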